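/- Let $\mathcal M$ be a connected smooth $n$-dimensional Riemannian manifold (without boundary) with Riemannian distance $d$, and let $\iota:\mathcal M\hookrightarrow\mathbb R^m$ be a smooth isometric embedding; write $T_y\mathcal M=d\iota_y(T_y\mathcal M)\subseteq\mathbb R^m$, and let $\mathrm{proj}_{T_y\mathcal M}:\mathbb R^m\to T_y\mathcal M$ be the orthogonal projection. Let $w_1,\dots,w_t>0$, $\{x\}=(x^{(1)},\dots,x^{(t)})\in\mathcal M^t$, and $$f(\{x\},y)=\sum_{l=1}^t w_l\,d(x^{(l)},y)^2 .$$ Let $\mu_{fr}:\mathcal M^t\to\mathcal M$ be such that $\mu_{fr}(\{x'\})$ minimizes $f(\{x'\},\cdot)$ over $\mathcal M$ for all $\{x'\}$ near $\{x\}$, and suppose that $\mu_{fr}$ is continuous at $\{x\}$. Put $\overline x=\mu_{fr}(\{x\})$, fix $i\in\{1,\dots,t\}$, and suppose that $f$, as a function of $(x^{(i)},y)$ with the other data points fixed, is twice differentiable at $(x^{(i)},\overline x)$. For $\{x'\}\in\mathcal M^t$ and $y\in\mathcal M$ let $\nabla_y f(\{x'\},y)\in T_y\mathcal M\subseteq\mathbb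 R^m$ be the gradient of $f(\{x'\},\cdot)$ along $\mathcal M$, regarded as a vector of $\mathbb R^m$. With total derivatives $\widetilde\nabla$ taken along $\mathcal M$, set $$f^p_{YY}=\widetilde\nabla_y\big(\mathrm{proj}_{T_{\overline x}\mathcal M}\circ\nabla_y f\big)(\{x\},\overline x),\qquad f^p_{X^{(i)}Y}=\widetilde\nabla_{x^{(i)}}\big(\mathrm{proj}_{T_{\overline x}\mathcal M}\circ\nabla_y f\big)(\{x\},\overline x),$$ which are linear maps $T_{\overline x}\mathcal M\to T_{\overline x}\mathcal M$ and $T_{x^{(i)}}\mathcal M\to T_{\overline x}\mathcal M$, and suppose that $f^p_{YY}$ is invertible. Then $\mu_{fr}$ is differentiable at $\{x\}$ in the variable $x^{(i)}$ and $$\widetilde\nabla_{x^{(i)}}\mu_{fr}(\{x\})=-\,(f^p_{YY})^{-1}\,f^p_{X^{(i)}Y}.$$ Moreover these quantities are computed by ambient Euclidean derivatives: let $F:\mathbb R^m\times\mathbb R^m\to\mathbb R$ be any function such that $F(\iota(z),\iota(y))=f(\{x\}\text{ with }x^{(i)}\text{ replaced by }z,\;y)$ for $(z,y)\in\mathcal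 M\times\mathcal M$ near $(x^{(i)},\overline x)$, and such that $F$ is differentiable in its second variable at all points near $(\iota(x^{(i)}),\iota(\overline x))$. Write $\nabla^{euc}_yF$ for the Euclidean gradient of $F$ in its second variable. Then 1. $\nabla_y f=\mathrm{proj}_{T_y\mathcal M}\,\nabla^{euc}_yF$ at all $(z,y)\in\mathcal M\times\mathcal M$ near $(x^{(i)},\overline x)$; 2. if moreover $\nabla^{euc}_yF$ is differentiable at $(\iota(x^{(i)}),\iota(\overline x))$ and its value there lies in $T_{\overline x}\mathcal M$ (has no normal component), then $f^p_{YY}$ and $f^p_{X^{(i)}Y}$ are the restrictions to $T_{\overline x}\mathcal M$, respectively $T_{x^{(i)}}\mathcal M$, of the Euclidean total derivatives at that point of $\mathrm{proj}_{T_{\overline x}\mathcal M}\circ\nabla^{euc}_yF$ in the second, respectively the first, variable. -/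

import Mathlib

open Manifold Bundle Filter Topology
open scoped ContDiff

noncomputable section

namespace FrechetMean

/-- Twice differentiability at a point of a real function on a manifold without boundary: the
function is differentiable near the point and its derivative, read in the preferred chart, is
differentiable at the point. -/
def TwiceMDifferentiableAt {E : Type*} [NormedAddCommGroup E] [NormedSpace ℝ E]
    {H : Type*} [TopologicalSpace H] (I : ModelWithCorners ℝ E H)
    {M : Type*} [TopologicalSpace M] [ChartedSpace H M] (φ : M → ℝ) (p : M) : Prop :=
  (∀ᶠ q in 𝓝 p, MDifferentiableAt I 𝓘(ℝ, ℝ) φ q) ∧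
    DifferentiableAt ℝ (fderiv ℝ (φ ∘ (extChartAt I p).symm)) (extChartAt I p p)

/-- The weighted Fréchet objective `f({x}, y) = ∑ l, w_l d(x_l, y)²`. -/
def objective {M : Type*} [MetricSpace M] {t : ℕ} (w : Fin t → ℝ) (x : Fin t → M) (y : M) : ℝ :=
  ∑ l, w l * dist (x l) y ^ 2

/-- `y` is a weighted Fréchet mean of `x`: it minimizes the Fréchet objective over `M`. -/
def IsFrechetMean {M : Type*} [MetricSpace M] {t : ℕ} (w : Fin t → ℝ) (x : Fin t → M) (y : M) :
    Prop :=
  ∀ y' : M, objective w x y ≤ objective w x y'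

section Riemannian

variable (n : ℕ) {m t : ℕ} {M : Type*} [MetricSpace M] [ChartedSpace (EuclideanSpace ℝ (Fin n)) M]

/-- The tangent space `T_y M`, as a linear subspace of the ambient Euclidean space. -/
def ambientTangentSpace (ι : M → EuclideanSpace ℝ (Fin m)) (y : M) :
    Submodule ℝ (EuclideanSpace ℝ (Fin m)) :=
  LinearMap.range (mfderiv (𝓡 n) (𝓡 m) ι y).toLinearMap

/-- The orthogonal projection `ℝ^m → T_y M`. -/
def tangentProj (ι : M → EuclideanSpace ℝ (Fin m)) (y : M) :
    EuclideanSpace ℝ (Fin m) →L[ℝ] ambientTangentSpace n ι y :=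
  (ambientTangentSpace n ι y).orthogonalProjectionOnto

variable [RiemannianBundle (fun y : M ↦ TangentSpace (𝓡 n) y)]

/-- `ι` is an isometric embedding of the Riemannian manifold `M` into `ℝ^m`: a smooth embedding
whose differential preserves inner products. -/
def IsIsometricEmbedding (ι : M → EuclideanSpace ℝ (Fin m)) : Prop :=
  IsSmoothEmbedding (𝓡 n) (𝓡 m) ∞ ι ∧
    ∀ (y : M) (u v : TangentSpace (𝓡 n) y),
      inner ℝ (mfderiv (𝓡 n) (𝓡 m) ι y u : EuclideanSpace ℝ (Fin m))
        (mfderiv (𝓡 n) (𝓡 m) ι y v : EuclideanSpace ℝ (Fin m)) = inner ℝ u v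

/-- The Riemannian gradient: the tangent vector representing the differential of `φ` at `y`. -/
def riemannianGradient (φ : M → ℝ) (y : M) : TangentSpace (𝓡 n) y :=
  haveI : FiniteDimensional ℝ (TangentSpace (𝓡 n) y) :=
    inferInstanceAs (FiniteDimensional ℝ (EuclideanSpace ℝ (Fin n)))
  haveI : CompleteSpace (TangentSpace (𝓡 n) y) := FiniteDimensional.complete ℝ _
  (InnerProductSpace.toDual ℝ (TangentSpace (𝓡 n) y)).symm (mfderiv (𝓡 n) 𝓘(ℝ, ℝ) φ y)

/-- The gradient of `φ : M → ℝ` at `y`, as a vector of the ambient `ℝ^m` tangent to `M` at `y`. -/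
def ambientGradient (ι : M → EuclideanSpace ℝ (Fin m)) (φ : M → ℝ) (y : M) :
    EuclideanSpace ℝ (Fin m) :=
  mfderiv (𝓡 n) (𝓡 m) ι y (riemannianGradient n φ y)

/-- The projected gradient `(x, y) ↦ proj_{T_b M} (∇_y f({x}, y))`, with a fixed base point `b`. -/
def projGradient (ι : M → EuclideanSpace ℝ (Fin m)) (w : Fin t → ℝ) (b : M)
    (x : Fin t → M) (y : M) : ambientTangentSpace n ι b :=
  tangentProj n ι b (ambientGradient n ι (objective w x) y)

/-- `f^p_{YY}({x}, b)`: the total derivative in `y`, at `y = b`, of the projected gradient. -/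
def fpYY (ι : M → EuclideanSpace ℝ (Fin m)) (w : Fin t → ℝ) (x : Fin t → M) (b : M) :
    TangentSpace (𝓡 n) b →L[ℝ] ambientTangentSpace n ι b :=
  mfderiv (𝓡 n) 𝓘(ℝ, ambientTangentSpace n ι b) (fun y ↦ projGradient n ι w b x y) b

/-- `f^p_{X^{(i)}Y}({x}, b)`: the total derivative in the `i`-th data point of the projected
gradient, at `y = b`. -/
def fpXY (ι : M → EuclideanSpace ℝ (Fin m)) (w : Fin t → ℝ) (x : Fin t → M) (b : M) (i : Fin t) :
    TangentSpace (𝓡 n) (x i) →L[ℝ] ambientTangentSpace n ι b :=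
  mfderiv (𝓡 n) 𝓘(ℝ, ambientTangentSpace n ι b)
    (fun z ↦ projGradient n ι w b (Function.update x i z) b) (x i)

end Riemannian

end FrechetMean

end

/-! Near `x` the mean minimizes a differentiable function, so the projected gradient vanishes along
`(z, μ (update x i z))`; solving its linearization at one point gives the formula. The gradient is
known to be differentiable only at that point, so the classical implicit function theorem does not
apply; the continuity of `μ` replaces it (`hasFDerivAt_of_implicit`).

Differentiability of the projected gradient comes from a chart formula. If `J` is the differential
of `ι` in coordinates, the ambient gradient is `J (JᵀJ)⁻¹` applied to the coordinate differential
(`ambientGradient_eq_gramLift`). Here `J` is smooth, and the differential is differentiable at the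
point by hypothesis.

For an extension `F`, the gradient on `M` is `P_y V`, where `V` is the Euclidean gradient and `P_y`
the tangential projection. With `R_y = 1 - P_y`, the difference between `P_b V` and `P_b P_y V` is
`(P_b R_y) (R_y V)`. If `V` is tangent at `b`, both factors vanish at `y = b`, so the moving
projection contributes nothing to first order (`hasMFDerivAt_tangentProj_tangentProj`). -/

namespace FrechetMean

/-! ### Implicit differentiation at one point. -/

section Implicit

variable {E E' F : Type*} [NormedAddCommGroup E] [NormedSpace ℝ E] [NormedAddCommGroup E']
  [NormedSpace ℝ E'] [NormedAddCommGroup F] [NormedSpace ℝ F]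

/-- Implicit differentiation at a single point: a continuous solution `ν` of `G (ζ, ν ζ) = const`
is differentiable as soon as `G` is differentiable at the point and its partial derivative in the
second variable is invertible. -/
theorem hasFDerivAt_of_implicit {G : E × E' → F} {A : E →L[ℝ] F} {B : E' →L[ℝ] F}
    (hB : B.IsInvertible) {ν : E → E'} {ζ₀ : E} (hν : ContinuousAt ν ζ₀)
    (hG : HasFDerivAt G (A.coprod B) (ζ₀, ν ζ₀))
    (h0 : ∀ᶠ ζ in 𝓝 ζ₀, G (ζ, ν ζ) = G (ζ₀, ν ζ₀)) :
    HasFDerivAt ν (-(B.inverse ∘L A)) ζ₀ := by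
  have ht : Tendsto (fun ζ ↦ (ζ, ν ζ)) (𝓝 ζ₀) (𝓝 (ζ₀, ν ζ₀)) :=
    (continuousAt_id.prodMk hν : ContinuousAt (fun ζ ↦ (ζ, ν ζ)) ζ₀)
  have hl := hG.isLittleO.comp_tendsto ht
  -- Along the solution the increment of `G` is zero, so its linearization is pure remainder; apply
  -- `-B⁻¹` to it.
  have hr : (fun ζ ↦ B.inverse (A (ζ - ζ₀)) + (ν ζ - ν ζ₀)) =o[𝓝 ζ₀]
      (fun ζ ↦ (ζ - ζ₀, ν ζ - ν ζ₀)) := by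
    refine ((-B.inverse).isBigO_comp _ _).trans_isLittleO hl |>.congr' ?_ ?_
    · filter_upwards [h0] with ζ hζ
      simp [hζ, hB]
    · exact Eventually.of_forall fun ζ ↦ by simp
  -- Adding this pair to the full increment cancels `ν ζ - ν ζ₀` and leaves a linear function of `ζ
  -- - ζ₀`. Since the pair is negligible, the full increment is `O(ζ - ζ₀)`.
  have hr' : (fun ζ ↦ ((0 : E), -(B.inverse (A (ζ - ζ₀)) + (ν ζ - ν ζ₀)))) =o[𝓝 ζ₀]
      (fun ζ ↦ (ζ - ζ₀, ν ζ - ν ζ₀)) := by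
    refine (Asymptotics.isLittleO_norm_left.2 hr).congr_left (fun ζ ↦ ?_) |>.of_norm_left
    simp [Prod.norm_def, -neg_add_rev]
  have hO : (fun ζ ↦ (ζ - ζ₀, ν ζ - ν ζ₀)) =O[𝓝 ζ₀] (fun ζ ↦ ζ - ζ₀) := by
    refine hr'.right_isBigO_add.trans ?_
    refine (((ContinuousLinearMap.id ℝ E).prod (-(B.inverse ∘L A))).isBigO_comp
      (fun ζ ↦ ζ - ζ₀) _).congr_left fun ζ ↦ ?_
    ext <;> simp
    abel
  rw [hasFDerivAt_iff_isLittleO]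
  refine (hr.trans_isBigO hO).congr_left fun ζ ↦ ?_
  simp
  abel

end Implicit

/-! ### Gram forms and projection onto the range of an injective map. -/

section LinearAlgebra

variable {E V : Type*} [NormedAddCommGroup E] [NormedSpace ℝ E]
  [NormedAddCommGroup V] [InnerProductSpace ℝ V]

/-- The map `v ↦ ⟪v, J ·⟫`. -/
noncomputable def pullbackInner (J : E →L[ℝ] V) : V →L[ℝ] E →L[ℝ] ℝ :=
  (ContinuousLinearMap.compL ℝ E V ℝ).flip J ∘L innerSL ℝ

@[simp] theorem pullbackInner_apply (J : E →L[ℝ] V) (v : V) (u : E) :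
    pullbackInner J v u = inner ℝ v (J u) := by
  rfl

/-- The Gram form of `J`, that is, the pullback of the inner product along `J`. -/
noncomputable def gram (J : E →L[ℝ] V) : E →L[ℝ] E →L[ℝ] ℝ := pullbackInner J ∘L J

/-- For injective `J`, the map taking a covector `d` to the vector of the range of `J` which
represents it. -/
noncomputable def gramLift (J : E →L[ℝ] V) : (E →L[ℝ] ℝ) →L[ℝ] V := J ∘L (gram J).inverse

/-- The Gram form is positive definite, hence injective, and `E` has the dimension of its dual.
Without invertibility `inverse` would take the default value zero. -/
theorem gram_isInvertible [FiniteDimensional ℝ E] {J : E →L[ℝ] V} (hJ : Function.Injective J) :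
    (gram J).IsInvertible := by
  have hinj : Function.Injective (gram J) := by
    rw [injective_iff_map_eq_zero]
    intro u hu
    have : inner ℝ (J u) (J u) = 0 := by
      simpa [gram] using DFunLike.congr_fun hu u
    rw [inner_self_eq_zero] at this
    exact hJ (by simpa using this)
  have hdim : Module.finrank ℝ E = Module.finrank ℝ (E →L[ℝ] ℝ) := by
    rw [← (LinearMap.toContinuousLinearMap (𝕜 := ℝ) (E := E) (F' := ℝ)).finrank_eq]
    exact (Subspace.dual_finrank_eq).symm
  refine ⟨(LinearEquiv.ofInjectiveOfFinrankEq (gram J).toLinearMap hinj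
    hdim).toContinuousLinearEquiv, ?_⟩
  rfl

/-- A vector of the range is determined by its inner products with the range. Both gradients and
orthogonal projections are identified this way. -/
theorem gramLift_eq_of_mem_range [FiniteDimensional ℝ E] {J : E →L[ℝ] V}
    (hJ : Function.Injective J) {d : E →L[ℝ] ℝ} {v : V} (hv : v ∈ Set.range J)
    (hd : ∀ u, inner ℝ v (J u) = d u) : gramLift J d = v := by
  obtain ⟨g, rfl⟩ := hv
  have : d = gram J g := by
    ext u
    simp [gram, ← hd]
  rw [this]
  simp [gramLift, gram_isInvertible hJ]

theorem differentiableAt_pullbackInner {X : Type*} [NormedAddCommGroup X] [NormedSpace ℝ X]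
    {J : X → E →L[ℝ] V} {p : X} (hJ : DifferentiableAt ℝ J p) :
    DifferentiableAt ℝ (fun q ↦ pullbackInner (J q)) p := by
  unfold pullbackInner
  fun_prop

theorem differentiableAt_clm_inverse {X W : Type*} [NormedAddCommGroup X] [NormedSpace ℝ X]
    [NormedAddCommGroup W] [NormedSpace ℝ W] [CompleteSpace E] {A : X → E →L[ℝ] W} {p : X}
    (hA : DifferentiableAt ℝ A p) (hinv : (A p).IsInvertible) :
    DifferentiableAt ℝ (fun q ↦ (A q).inverse) p :=
  ((hinv.contDiffAt_map_inverse (n := 1)).differentiableAt one_ne_zero).comp p hA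

theorem differentiableAt_gramLift [FiniteDimensional ℝ E] {X : Type*} [NormedAddCommGroup X]
    [NormedSpace ℝ X] {J : X → E →L[ℝ] V} {p : X} (hJ : DifferentiableAt ℝ J p)
    (hinj : Function.Injective (J p)) : DifferentiableAt ℝ (fun q ↦ gramLift (J q)) p := by
  have : CompleteSpace E := FiniteDimensional.complete ℝ E
  have hg : DifferentiableAt ℝ (fun q ↦ gram (J q)) p :=
    (differentiableAt_pullbackInner hJ).clm_comp hJ
  have hi : DifferentiableAt ℝ (fun q ↦ (gram (J q)).inverse) p :=
    differentiableAt_clm_inverse hg (gram_isInvertible hinj)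
  exact hJ.clm_comp hi

/-- The orthogonal projection onto the range of an injective `J`. -/
noncomputable def rangeProj (J : E →L[ℝ] V) : V →L[ℝ] V := gramLift J ∘L pullbackInner J

theorem rangeProj_eq [FiniteDimensional ℝ E] {J : E →L[ℝ] V} (hJ : Function.Injective J)
    (K : Submodule ℝ V) [K.HasOrthogonalProjection] (hK : (K : Set V) = Set.range J) (v : V) :
    rangeProj J v = K.orthogonalProjectionOnto v := by
  refine gramLift_eq_of_mem_range hJ (hK ▸ (K.orthogonalProjectionOnto v).2) fun u ↦ ?_
  have hu : J u ∈ K := by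
    rw [← SetLike.mem_coe, hK]; exact ⟨u, rfl⟩
  exact K.inner_orthogonalProjectionOnto_eq_of_mem_right ⟨J u, hu⟩ v

end LinearAlgebra

/-! ### Derivatives on a manifold read in a fixed chart. -/

section Charts

variable {E : Type*} [NormedAddCommGroup E] [NormedSpace ℝ E] {H : Type*} [TopologicalSpace H]
  {I : ModelWithCorners ℝ E H} {M : Type*} [TopologicalSpace M]
  [ChartedSpace H M] {V : Type*} [NormedAddCommGroup V] [NormedSpace ℝ V]

theorem hasMFDerivAt_of_hasFDerivAt_comp_extChartAt_symm {φ : M → V} {b : M} {L : E →L[ℝ] V}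
    (h : HasFDerivAt (φ ∘ (extChartAt I b).symm) L (extChartAt I b b)) :
    HasMFDerivAt I 𝓘(ℝ, V) φ b L := by
  refine ⟨?_, ?_⟩
  · refine (h.continuousAt.comp (continuousAt_extChartAt b)).congr ?_
    filter_upwards [extChartAt_source_mem_nhds (I := I) b] with y hy
    exact congrArg φ ((extChartAt I b).left_inv hy)
  · exact h.hasFDerivWithinAt

variable [I.Boundaryless] [IsManifold I 1 M]

theorem differentiableAt_comp_extChartAt_symm {φ : M → V} {b y : M}
    (hy : y ∈ (extChartAt I b).source) (hφ : MDifferentiableAt I 𝓘(ℝ, V) φ y) :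
    DifferentiableAt ℝ (φ ∘ (extChartAt I b).symm) (extChartAt I b y) := by
  have hs := mdifferentiableWithinAt_extChartAt_symm (I := I) ((extChartAt I b).map_source hy)
  rw [I.range_eq_univ, mdifferentiableWithinAt_univ] at hs
  rw [← mdifferentiableAt_iff_differentiableAt]
  refine MDifferentiableAt.comp (I' := I) _ ?_ hs
  rwa [(extChartAt I b).left_inv hy]

theorem mfderiv_eq_fderiv_comp_extChartAt {φ : M → V} {b y : M}
    (hy : y ∈ (extChartAt I b).source) (hφ : MDifferentiableAt I 𝓘(ℝ, V) φ y) :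
    mfderiv I 𝓘(ℝ, V) φ y =
      fderiv ℝ (φ ∘ (extChartAt I b).symm) (extChartAt I b y) ∘L
        mfderiv I 𝓘(ℝ, E) (extChartAt I b) y := by
  have hd := (differentiableAt_comp_extChartAt_symm hy hφ).hasFDerivAt.hasMFDerivAt
  have he := (mdifferentiableAt_extChartAt (I := I) (x := b) (y := y)
    (by simpa using hy)).hasMFDerivAt
  refine ((hd.comp y he).congr_of_eventuallyEq ?_).mfderiv
  filter_upwards [(isOpen_extChartAt_source (I := I) b).mem_nhds hy] with z hz
  exact congrArg φ ((extChartAt I b).left_inv hz).symm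

end Charts

/-! ### Tangent spaces, projections and gradients in coordinates. -/

section Riemannian

variable {n m : ℕ} {M : Type*} [MetricSpace M] [ChartedSpace (EuclideanSpace ℝ (Fin n)) M]
  {ι : M → EuclideanSpace ℝ (Fin m)}

/-- The differential of `ι` read in the preferred chart at `b`. -/
noncomputable def coordDeriv (n : ℕ) {m : ℕ} {M : Type*} [MetricSpace M]
    [ChartedSpace (EuclideanSpace ℝ (Fin n)) M] (ι : M → EuclideanSpace ℝ (Fin m)) (b : M)
    (η : EuclideanSpace ℝ (Fin n)) : EuclideanSpace ℝ (Fin n) →L[ℝ] EuclideanSpace ℝ (Fin m) :=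
  fderiv ℝ (ι ∘ (extChartAt (𝓡 n) b).symm) η

theorem differentiableAt_coordDeriv [IsManifold (𝓡 n) ∞ M] (hι : ContMDiff (𝓡 n) (𝓡 m) ∞ ι)
    (b : M) : DifferentiableAt ℝ (coordDeriv n ι b) (extChartAt (𝓡 n) b b) := by
  have hc : ContDiffAt ℝ ∞ (ι ∘ (extChartAt (𝓡 n) b).symm) (extChartAt (𝓡 n) b b) := by
    rw [← contMDiffAt_iff_contDiffAt]
    exact hι.contMDiffAt.comp _ ((contMDiffOn_extChartAt_symm b).contMDiffAt
      (extChartAt_target_mem_nhds b))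
  exact (hc.fderiv_right (m := 1) (by norm_cast)).differentiableAt one_ne_zero

theorem mfderiv_extChartAt_bijective [IsManifold (𝓡 n) ∞ M] {b y : M} (hy : y ∈ (extChartAt (𝓡 n) b).source) :
    Function.Bijective
      (mfderiv (𝓡 n) 𝓘(ℝ, EuclideanSpace ℝ (Fin n)) (extChartAt (𝓡 n) b) y) := by
  have : IsManifold (𝓡 n) 1 M := .of_le (n := ∞) (by simp)
  exact (isInvertible_mfderiv_extChartAt hy).bijective

variable [RiemannianBundle (fun y : M ↦ TangentSpace (𝓡 n) y)]

theorem IsIsometricEmbedding.mfderiv_injective (hι : IsIsometricEmbedding n ι) (y : M) :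
    Function.Injective (mfderiv (𝓡 n) (𝓡 m) ι y) := by
  rw [injective_iff_map_eq_zero]
  intro u hu
  have h := hι.2 y u u
  rw [hu] at h
  have h0 : inner ℝ u u = 0 := by
    rw [← h]; exact inner_zero_left (𝕜 := ℝ) (0 : EuclideanSpace ℝ (Fin m))
  exact inner_self_eq_zero.1 h0

theorem IsIsometricEmbedding.mdifferentiableAt (hι : IsIsometricEmbedding n ι) (y : M) :
    MDifferentiableAt (𝓡 n) (𝓡 m) ι y :=
  hι.1.contMDiff.mdifferentiableAt (by simp)

theorem inner_ambientGradient (hι : IsIsometricEmbedding n ι) (φ : M → ℝ) (y : M)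
    (u : TangentSpace (𝓡 n) y) :
    inner ℝ (ambientGradient n ι φ y) (mfderiv (𝓡 n) (𝓡 m) ι y u : EuclideanSpace ℝ (Fin m)) =
      mfderiv (𝓡 n) 𝓘(ℝ, ℝ) φ y u := by
  have : FiniteDimensional ℝ (TangentSpace (𝓡 n) y) :=
    inferInstanceAs (FiniteDimensional ℝ (EuclideanSpace ℝ (Fin n)))
  have : CompleteSpace (TangentSpace (𝓡 n) y) := FiniteDimensional.complete ℝ _
  refine (hι.2 y (riemannianGradient n φ y) u).trans ?_
  exact InnerProductSpace.toDual_symm_apply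

/-- The gradient of a restriction is the tangential part of the ambient gradient. -/
theorem ambientGradient_eq_tangentProj (hι : IsIsometricEmbedding n ι) {φ : M → ℝ}
    {Φ : EuclideanSpace ℝ (Fin m) → ℝ} {y : M} (h : ∀ᶠ y' in 𝓝 y, Φ (ι y') = φ y')
    (hΦ : DifferentiableAt ℝ Φ (ι y)) :
    ambientGradient n ι φ y = tangentProj n ι y (gradient Φ (ι y)) := by
  have hd : mfderiv (𝓡 n) 𝓘(ℝ, ℝ) φ y = fderiv ℝ Φ (ι y) ∘L mfderiv (𝓡 n) (𝓡 m) ι y :=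
    ((hΦ.hasFDerivAt.hasMFDerivAt.comp y (hι.mdifferentiableAt y).hasMFDerivAt
      ).congr_of_eventuallyEq (h.mono fun _ h ↦ h.symm)).mfderiv
  refine (Submodule.eq_starProjection_of_mem_of_inner_eq_zero
    (K := ambientTangentSpace n ι y) ?_ ?_).symm
  · exact ⟨riemannianGradient n φ y, rfl⟩
  · rintro _ ⟨u, rfl⟩
    have h1 := inner_ambientGradient hι φ y u
    rw [hd] at h1
    have h2 : inner ℝ (gradient Φ (ι y)) (mfderiv (𝓡 n) (𝓡 m) ι y u : EuclideanSpace ℝ (Fin m)) =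
        fderiv ℝ Φ (ι y) (mfderiv (𝓡 n) (𝓡 m) ι y u) := InnerProductSpace.toDual_symm_apply
    rw [inner_sub_left]
    exact sub_eq_zero.2 (h2.trans h1.symm)

variable [IsManifold (𝓡 n) ∞ M]

theorem mfderiv_eq_coordDeriv_comp (hι : IsIsometricEmbedding n ι) {b y : M}
    (hy : y ∈ (extChartAt (𝓡 n) b).source) :
    mfderiv (𝓡 n) (𝓡 m) ι y = coordDeriv n ι b (extChartAt (𝓡 n) b y) ∘L
      mfderiv (𝓡 n) 𝓘(ℝ, EuclideanSpace ℝ (Fin n)) (extChartAt (𝓡 n) b) y := by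
  have : IsManifold (𝓡 n) 1 M := .of_le (n := ∞) (by simp)
  exact mfderiv_eq_fderiv_comp_extChartAt hy (hι.mdifferentiableAt y)

theorem coordDeriv_injective (hι : IsIsometricEmbedding n ι) {b y : M}
    (hy : y ∈ (extChartAt (𝓡 n) b).source) :
    Function.Injective (coordDeriv n ι b (extChartAt (𝓡 n) b y)) := by
  have h := hι.mfderiv_injective y
  rw [mfderiv_eq_coordDeriv_comp hι hy] at h
  exact Function.Injective.of_comp_right (f := coordDeriv n ι b (extChartAt (𝓡 n) b y)) h
    (mfderiv_extChartAt_bijective hy).2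

/-- The two differentials differ by the derivative of the chart, which is bijective, so their ranges
agree. -/
theorem coe_ambientTangentSpace (hι : IsIsometricEmbedding n ι) {b y : M}
    (hy : y ∈ (extChartAt (𝓡 n) b).source) :
    (ambientTangentSpace n ι y : Set (EuclideanSpace ℝ (Fin m))) =
      Set.range (coordDeriv n ι b (extChartAt (𝓡 n) b y)) := by
  have : (ambientTangentSpace n ι y : Set (EuclideanSpace ℝ (Fin m))) =
      Set.range (mfderiv (𝓡 n) (𝓡 m) ι y) := rfl
  rw [this, mfderiv_eq_coordDeriv_comp hι hy]
  exact (mfderiv_extChartAt_bijective hy).2.range_comp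
    (coordDeriv n ι b (extChartAt (𝓡 n) b y))

theorem coe_tangentProj (hι : IsIsometricEmbedding n ι) {b y : M}
    (hy : y ∈ (extChartAt (𝓡 n) b).source) (v : EuclideanSpace ℝ (Fin m)) :
    (tangentProj n ι y v : EuclideanSpace ℝ (Fin m)) =
      rangeProj (coordDeriv n ι b (extChartAt (𝓡 n) b y)) v :=
  (rangeProj_eq (coordDeriv_injective hι hy) _ (coe_ambientTangentSpace hι hy) v).symm

/-- Inner products with the range of `J` characterize the gradient. The formula uses only maps
between fixed vector spaces, so it can be differentiated in `y`. -/
theorem ambientGradient_eq_gramLift (hι : IsIsometricEmbedding n ι) {φ : M → ℝ} {b y : M}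
    (hy : y ∈ (extChartAt (𝓡 n) b).source) (hφ : MDifferentiableAt (𝓡 n) 𝓘(ℝ, ℝ) φ y) :
    ambientGradient n ι φ y = gramLift (coordDeriv n ι b (extChartAt (𝓡 n) b y))
      (fderiv ℝ (φ ∘ (extChartAt (𝓡 n) b).symm) (extChartAt (𝓡 n) b y)) := by
  have : IsManifold (𝓡 n) 1 M := .of_le (n := ∞) (by simp)
  refine (gramLift_eq_of_mem_range (coordDeriv_injective hι hy) ?_ fun u ↦ ?_).symm
  · rw [← coe_ambientTangentSpace hι hy]
    exact ⟨riemannianGradient n φ y, rfl⟩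
  · obtain ⟨u, rfl⟩ := (mfderiv_extChartAt_bijective hy).2 u
    have h := inner_ambientGradient hι φ y u
    rw [mfderiv_eq_coordDeriv_comp hι hy, mfderiv_eq_fderiv_comp_extChartAt hy hφ] at h
    exact h

end Riemannian

/-! ### Differentiability of the projected gradient. -/

section ProjectedGradient

variable {n m : ℕ} {M : Type*} [MetricSpace M] [ChartedSpace (EuclideanSpace ℝ (Fin n)) M]
  [IsManifold (𝓡 n) ∞ M] [RiemannianBundle (fun y : M ↦ TangentSpace (𝓡 n) y)]
  {ι : M → EuclideanSpace ℝ (Fin m)}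

/-- Near a point where `f` is twice differentiable, the projected gradient of `f` in its second
variable, read in charts, is differentiable at that point. -/
theorem differentiableAt_projected_gradient (hι : IsIsometricEmbedding n ι) {f : M → M → ℝ}
    {a b : M}
    (hf : TwiceMDifferentiableAt ((𝓡 n).prod (𝓡 n)) (fun p : M × M ↦ f p.1 p.2) (a, b)) :
    DifferentiableAt ℝ (fun q : EuclideanSpace ℝ (Fin n) × EuclideanSpace ℝ (Fin n) ↦
      tangentProj n ι b (ambientGradient n ι (f ((extChartAt (𝓡 n) a).symm q.1))
        ((extChartAt (𝓡 n) b).symm q.2))) (extChartAt (𝓡 n) a a, extChartAt (𝓡 n) b b) := by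
  have : IsManifold (𝓡 n) 1 M := .of_le (n := ∞) (by simp)
  obtain ⟨hf1, hf2⟩ := hf
  set D := fderiv ℝ ((fun p : M × M ↦ f p.1 p.2) ∘
    (extChartAt ((𝓡 n).prod (𝓡 n)) (a, b)).symm) with hD
  have hJ : DifferentiableAt ℝ
      (fun q : EuclideanSpace ℝ (Fin n) × EuclideanSpace ℝ (Fin n) ↦ coordDeriv n ι b q.2)
      (extChartAt (𝓡 n) a a, extChartAt (𝓡 n) b b) :=
    (differentiableAt_coordDeriv hι.1.contMDiff b).comp
      (f := fun q : EuclideanSpace ℝ (Fin n) × EuclideanSpace ℝ (Fin n) ↦ q.2)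
      (extChartAt (𝓡 n) a a, extChartAt (𝓡 n) b b) differentiableAt_snd
  have hL := differentiableAt_gramLift hJ (coordDeriv_injective hι (mem_extChartAt_source b))
  have hD' : DifferentiableAt ℝ
      (fun q ↦ D q ∘L ContinuousLinearMap.inr ℝ (EuclideanSpace ℝ (Fin n))
        (EuclideanSpace ℝ (Fin n)))
      (extChartAt (𝓡 n) a a, extChartAt (𝓡 n) b b) :=
    DifferentiableAt.clm_comp hf2 (differentiableAt_const _)
  refine ((tangentProj n ι b).differentiableAt.comp _ (hL.clm_apply hD')).congr_of_eventuallyEq ?_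
  have hta : ∀ᶠ q in 𝓝 (extChartAt (𝓡 n) a a, extChartAt (𝓡 n) b b),
      q.1 ∈ (extChartAt (𝓡 n) a).target :=
    continuousAt_fst.tendsto.eventually (extChartAt_target_mem_nhds (I := 𝓡 n) a)
  have htb : ∀ᶠ q in 𝓝 (extChartAt (𝓡 n) a a, extChartAt (𝓡 n) b b),
      q.2 ∈ (extChartAt (𝓡 n) b).target :=
    continuousAt_snd.tendsto.eventually (extChartAt_target_mem_nhds (I := 𝓡 n) b)
  have hc : Tendsto (fun q : EuclideanSpace ℝ (Fin n) × EuclideanSpace ℝ (Fin n) ↦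
      ((extChartAt (𝓡 n) a).symm q.1, (extChartAt (𝓡 n) b).symm q.2))
      (𝓝 (extChartAt (𝓡 n) a a, extChartAt (𝓡 n) b b)) (𝓝 (a, b)) := by
    have h := (continuousAt_extChartAt_symm (I := 𝓡 n) a).tendsto.prodMap_nhds
      (continuousAt_extChartAt_symm (I := 𝓡 n) b).tendsto
    rwa [extChartAt_to_inv, extChartAt_to_inv] at h
  filter_upwards [hta, htb, hc.eventually hf1] with q ha hb hq
  have hzs := (extChartAt (𝓡 n) a).map_target ha
  have hys := (extChartAt (𝓡 n) b).map_target hb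
  have hrz := (extChartAt (𝓡 n) a).right_inv ha
  have hry := (extChartAt (𝓡 n) b).right_inv hb
  set z := (extChartAt (𝓡 n) a).symm q.1 with hz
  set y := (extChartAt (𝓡 n) b).symm q.2 with hy
  have hfz : MDifferentiableAt (𝓡 n) 𝓘(ℝ, ℝ) (f z) y :=
    MDifferentiableAt.comp (I' := (𝓡 n).prod (𝓡 n)) (g := fun p : M × M ↦ f p.1 p.2)
      (f := fun y ↦ (z, y)) y hq (mdifferentiableAt_const.prodMk mdifferentiableAt_id)
  have hdq := differentiableAt_comp_extChartAt_symm (I := (𝓡 n).prod (𝓡 n)) (b := (a, b))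
    (y := (z, y)) (by rw [extChartAt_prod]; exact ⟨hzs, hys⟩) hq
  have hqe : extChartAt ((𝓡 n).prod (𝓡 n)) (a, b) (z, y) = q := by
    rw [extChartAt_prod]; exact Prod.ext hrz hry
  rw [hqe] at hdq
  -- The differential in `y` alone is the full differential restricted to the second factor.
  have hpart : fderiv ℝ (f z ∘ (extChartAt (𝓡 n) b).symm) q.2 =
      D q ∘L ContinuousLinearMap.inr ℝ (EuclideanSpace ℝ (Fin n)) (EuclideanSpace ℝ (Fin n)) := by
    have h := HasFDerivAt.comp (f := fun η ↦ (q.1, η)) q.2 hdq.hasFDerivAt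
      (hasFDerivAt_prodMk_right q.1 q.2)
    rw [← h.fderiv]
    congr 1
  have key := ambientGradient_eq_gramLift hι hys hfz
  rw [hry, hpart] at key
  simp only [Function.comp, key]

/-- Each term of the product rule retains one undifferentiated factor, and both factors vanish at
`p`. -/
theorem hasFDerivAt_clm_apply_zero {X Y Z : Type*} [NormedAddCommGroup X] [NormedSpace ℝ X]
    [NormedAddCommGroup Y] [NormedSpace ℝ Y] [NormedAddCommGroup Z] [NormedSpace ℝ Z]
    {c : X → Y →L[ℝ] Z} {u : X → Y} {p : X} (hc : DifferentiableAt ℝ c p)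
    (hu : DifferentiableAt ℝ u p) (hc0 : c p = 0) (hu0 : u p = 0) :
    HasFDerivAt (fun q ↦ c q (u q)) (0 : X →L[ℝ] Z) p := by
  have h := hc.hasFDerivAt.clm_apply hu.hasFDerivAt
  rw [hc0, hu0] at h
  refine h.congr_fderiv ?_
  ext v
  simp

theorem tangentProj_coe {n m : ℕ} {M : Type*} [MetricSpace M]
    [ChartedSpace (EuclideanSpace ℝ (Fin n)) M] {ι : M → EuclideanSpace ℝ (Fin m)} (y : M)
    (v : ambientTangentSpace n ι y) : tangentProj n ι y v = v :=
  Submodule.orthogonalProjectionOnto_mem_subspace_eq_self v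

/-- If `V` is tangent to `M` at `b`, then projecting `V y` to `T_y M` first does not change the
derivative at `b` of the projection of `V` to `T_b M`. -/
theorem hasMFDerivAt_tangentProj_tangentProj (hι : IsIsometricEmbedding n ι)
    {V : M → EuclideanSpace ℝ (Fin m)} {b : M}
    {V' : EuclideanSpace ℝ (Fin n) →L[ℝ] EuclideanSpace ℝ (Fin m)}
    (hV : HasFDerivAt (V ∘ (extChartAt (𝓡 n) b).symm) V' (extChartAt (𝓡 n) b b))
    (hb : V b ∈ ambientTangentSpace n ι b) :
    HasMFDerivAt (𝓡 n) 𝓘(ℝ, ambientTangentSpace n ι b)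
      (fun y ↦ tangentProj n ι b (tangentProj n ι y (V y))) b (tangentProj n ι b ∘L V') := by
  set e := extChartAt (𝓡 n) b with he
  have hJ := differentiableAt_coordDeriv hι.1.contMDiff b
  have hP : DifferentiableAt ℝ (fun η ↦ rangeProj (coordDeriv n ι b η)) (e b) :=
    (differentiableAt_gramLift hJ (coordDeriv_injective hι (mem_extChartAt_source b))).clm_comp
      (differentiableAt_pullbackInner hJ)
  -- `R` is the normal projection at the moving point.
  set R := fun η ↦ ContinuousLinearMap.id ℝ (EuclideanSpace ℝ (Fin m)) -
    rangeProj (coordDeriv n ι b η) with hRdef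
  have hR : DifferentiableAt ℝ R (e b) := (differentiableAt_const _).sub hP
  have hRb : ∀ v, R (e b) v = v - tangentProj n ι b v := fun v ↦ by
    simp [hRdef, coe_tangentProj hι (mem_extChartAt_source b), he]
  have hc : DifferentiableAt ℝ (fun η ↦ tangentProj n ι b ∘L R η) (e b) :=
    (differentiableAt_const _).clm_comp hR
  have hu : DifferentiableAt ℝ (fun η ↦ R η ((V ∘ e.symm) η)) (e b) :=
    hR.clm_apply hV.differentiableAt
  have hc0 : tangentProj n ι b ∘L R (e b) = 0 := by
    ext1 v
    rw [ContinuousLinearMap.comp_apply, hRb, map_sub, tangentProj_coe, sub_self]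
    rfl
  have hu0 : R (e b) ((V ∘ e.symm) (e b)) = 0 := by
    have : (V ∘ e.symm) (e b) = V b := congrArg V (extChartAt_to_inv (I := 𝓡 n) b)
    rw [this, hRb, sub_eq_zero]
    exact ((Submodule.starProjection_eq_self_iff).2 hb).symm
  have hcu := hasFDerivAt_clm_apply_zero hc hu hc0 hu0
  have hmain := ((tangentProj n ι b).hasFDerivAt.comp _ hV).sub hcu
  apply hasMFDerivAt_of_hasFDerivAt_comp_extChartAt_symm
  refine (hmain.congr_of_eventuallyEq ?_).congr_fderiv ?_
  · filter_upwards [extChartAt_target_mem_nhds (I := 𝓡 n) b] with η hη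
    have hys := e.map_target hη
    have hpe : ∀ v, (tangentProj n ι (e.symm η) v : EuclideanSpace ℝ (Fin m)) = v - R η v := by
      intro v
      rw [coe_tangentProj hι hys, ← he, e.right_inv hη]
      simp [hRdef]
    -- Idempotence splits the normal part into a product of two factors that both vanish at `b`.
    have hRR : ∀ v, R η (R η v) = R η v := by
      intro v
      have h1 : R η v = v - tangentProj n ι (e.symm η) v := by rw [hpe]; abel
      have h2 : R η (tangentProj n ι (e.symm η) v) = 0 := by
        have h3 := hpe (tangentProj n ι (e.symm η) v)
        rw [tangentProj_coe] at h3
        exact sub_eq_self.1 h3.symm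
      conv_lhs => rw [h1, map_sub, h2, sub_zero]
    change tangentProj n ι b (tangentProj n ι (e.symm η) (V (e.symm η))) =
      tangentProj n ι b (V (e.symm η)) - tangentProj n ι b (R η (R η (V (e.symm η))))
    rw [hpe, hRR, map_sub]
  · exact sub_zero _

end ProjectedGradient

/-! ### First-order condition and derivative of the mean. -/

section Main

theorem tendsto_update_self {t : ℕ} {M : Type*} [TopologicalSpace M]
    (x : Fin t → M) (i : Fin t) : Tendsto (fun z ↦ Function.update x i z) (𝓝 (x i)) (𝓝 x) := by
  have h : Continuous fun z : M ↦ Function.update x i z := continuous_const.update i continuous_id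
  simpa using h.tendsto (x i)

variable {n m t : ℕ} {M : Type*} [MetricSpace M] [ChartedSpace (EuclideanSpace ℝ (Fin n)) M]
  [RiemannianBundle (fun y : M ↦ TangentSpace (𝓡 n) y)]
  {ι : M → EuclideanSpace ℝ (Fin m)}

theorem IsIsometricEmbedding.hasFDerivAt (hι : IsIsometricEmbedding n ι) (b : M) :
    HasFDerivAt (ι ∘ (extChartAt (𝓡 n) b).symm)
      (mfderiv (𝓡 n) (𝓡 m) ι b :
        EuclideanSpace ℝ (Fin n) →L[ℝ] EuclideanSpace ℝ (Fin m)) (extChartAt (𝓡 n) b b) := by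
  have h := (hι.mdifferentiableAt b).hasMFDerivAt.2
  rw [(𝓡 n).range_eq_univ] at h
  exact h.hasFDerivAt univ_mem

theorem eventually_ambientGradient_eq (hι : IsIsometricEmbedding n ι) {f : M → M → ℝ} {a b : M}
    {F : EuclideanSpace ℝ (Fin m) → EuclideanSpace ℝ (Fin m) → ℝ}
    (hF : ∀ᶠ p : M × M in 𝓝 (a, b), F (ι p.1) (ι p.2) = f p.1 p.2)
    (hFd : ∀ᶠ q in 𝓝 (ι a, ι b), DifferentiableAt ℝ (F q.1) q.2) :
    ∀ᶠ p : M × M in 𝓝 (a, b), ambientGradient n ι (f p.1) p.2 =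
      tangentProj n ι p.2 (gradient (F (ι p.1)) (ι p.2)) := by
  have hc := hι.1.contMDiff.continuous
  have ht : Tendsto (fun p : M × M ↦ (ι p.1, ι p.2)) (𝓝 (a, b)) (𝓝 (ι a, ι b)) :=
    ((hc.comp continuous_fst).prodMk (hc.comp continuous_snd)).tendsto (a, b)
  filter_upwards [hF.eventually_nhds, ht.eventually hFd] with p hp hd
  refine ambientGradient_eq_tangentProj hι ?_ hd
  have hi : Tendsto (fun y ↦ (p.1, y)) (𝓝 p.2) (𝓝 p) :=
    (Continuous.prodMk_right p.1).tendsto p.2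
  exact hi.eventually hp

/-- Here `y` stays at `b`, so the inner projection does not move and is absorbed by the outer one;
no tangency of `V` is required. -/
theorem fpXY_eq_of_extension (hι : IsIsometricEmbedding n ι) {w : Fin t → ℝ} {x : Fin t → M}
    {b : M} {i : Fin t} {V : EuclideanSpace ℝ (Fin m) → EuclideanSpace ℝ (Fin m)}
    (hV : ∀ᶠ z in 𝓝 (x i), ambientGradient n ι (objective w (Function.update x i z)) b =
      tangentProj n ι b (V (ι z)))
    (hVd : DifferentiableAt ℝ V (ι (x i))) :
    fpXY n ι w x b i =
      fderiv ℝ (fun v ↦ tangentProj n ι b (V v)) (ι (x i)) ∘L mfderiv (𝓡 n) (𝓡 m) ι (x i) := by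
  have hd : DifferentiableAt ℝ (fun v ↦ tangentProj n ι b (V v)) (ι (x i)) :=
    (tangentProj n ι b).differentiableAt.comp (ι (x i)) hVd
  refine ((hd.hasFDerivAt.hasMFDerivAt.comp (x i)
    (hι.mdifferentiableAt (x i)).hasMFDerivAt).congr_of_eventuallyEq ?_).mfderiv
  filter_upwards [hV] with z hz
  simp only [projGradient, hz, Function.comp, tangentProj_coe]

variable [IsManifold (𝓡 n) ∞ M]

theorem ambientGradient_eq_zero_of_forall_le (hι : IsIsometricEmbedding n ι) {φ : M → ℝ} {y : M}
    (hφ : MDifferentiableAt (𝓡 n) 𝓘(ℝ, ℝ) φ y) (hmin : ∀ y', φ y ≤ φ y') :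
    ambientGradient n ι φ y = 0 := by
  have hloc : IsLocalMin (φ ∘ (extChartAt (𝓡 n) y).symm) (extChartAt (𝓡 n) y y) :=
    Eventually.of_forall fun η ↦ by
      simpa only [Function.comp, extChartAt_to_inv] using hmin _
  rw [ambientGradient_eq_gramLift hι (mem_extChartAt_source y) hφ, hloc.fderiv_eq_zero, map_zero]

/-- The projected gradient of the objective in the `i`-th data point and in `y`, read in the
preferred charts at `x i` and `b`. -/
noncomputable def coordProjGradient (ι : M → EuclideanSpace ℝ (Fin m)) (w : Fin t → ℝ)
    (x : Fin t → M) (b : M) (i : Fin t)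
    (q : EuclideanSpace ℝ (Fin n) × EuclideanSpace ℝ (Fin n)) : ambientTangentSpace n ι b :=
  projGradient n ι w b (Function.update x i ((extChartAt (𝓡 n) (x i)).symm q.1))
    ((extChartAt (𝓡 n) b).symm q.2)

/-- Joint differentiability is already known; restricting the derivative to the two coordinate
slices identifies its blocks. -/
theorem hasFDerivAt_coordProjGradient (hι : IsIsometricEmbedding n ι) {w : Fin t → ℝ}
    {x : Fin t → M} {b : M} {i : Fin t}
    (hf : TwiceMDifferentiableAt ((𝓡 n).prod (𝓡 n))
      (fun p : M × M ↦ objective w (Function.update x i p.1) p.2) (x i, b)) :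
    HasFDerivAt (coordProjGradient ι w x b i)
      (ContinuousLinearMap.coprod
        (fpXY n ι w x b i : EuclideanSpace ℝ (Fin n) →L[ℝ] ambientTangentSpace n ι b)
        (fpYY n ι w x b : EuclideanSpace ℝ (Fin n) →L[ℝ] ambientTangentSpace n ι b))
      (extChartAt (𝓡 n) (x i) (x i), extChartAt (𝓡 n) b b) := by
  have hG : HasFDerivAt (coordProjGradient ι w x b i) _
      (extChartAt (𝓡 n) (x i) (x i), extChartAt (𝓡 n) b b) :=
    (differentiableAt_projected_gradient hι
      (f := fun z ↦ objective w (Function.update x i z)) hf).hasFDerivAt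
  set G' := fderiv ℝ (fun q : EuclideanSpace ℝ (Fin n) × EuclideanSpace ℝ (Fin n) ↦
      tangentProj n ι b (ambientGradient n ι
        (objective w (Function.update x i ((extChartAt (𝓡 n) (x i)).symm q.1)))
        ((extChartAt (𝓡 n) b).symm q.2))) (extChartAt (𝓡 n) (x i) (x i), extChartAt (𝓡 n) b b)
  have hY : fpYY n ι w x b = G' ∘L ContinuousLinearMap.inr ℝ _ _ := by
    refine (hasMFDerivAt_of_hasFDerivAt_comp_extChartAt_symm (I := 𝓡 n) ?_).mfderiv
    refine (hG.comp (f := fun η ↦ (extChartAt (𝓡 n) (x i) (x i), η)) _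
      (hasFDerivAt_prodMk_right _ _)).congr_of_eventuallyEq (Eventually.of_forall fun η ↦ ?_)
    simp only [Function.comp, coordProjGradient, extChartAt_to_inv, Function.update_eq_self]
  have hX : fpXY n ι w x b i = G' ∘L ContinuousLinearMap.inl ℝ _ _ := by
    refine (hasMFDerivAt_of_hasFDerivAt_comp_extChartAt_symm (I := 𝓡 n) ?_).mfderiv
    refine (hG.comp (f := fun ζ ↦ (ζ, extChartAt (𝓡 n) b b)) _
      (hasFDerivAt_prodMk_left _ _)).congr_of_eventuallyEq (Eventually.of_forall fun ζ ↦ ?_)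
    simp only [Function.comp, coordProjGradient, extChartAt_to_inv]
  refine hG.congr_fderiv ?_
  rw [hX, hY]
  exact (ContinuousLinearMap.coprod_comp_inl_inr G').symm

/-- The Fréchet mean satisfies the first-order condition `∇_y f = 0`. -/
theorem eventually_projGradient_eq_zero (hι : IsIsometricEmbedding n ι) {w : Fin t → ℝ}
    {x : Fin t → M} {i : Fin t} {μ : (Fin t → M) → M}
    (hμ : ∀ᶠ x' in 𝓝 x, IsFrechetMean w x' (μ x')) (hμc : ContinuousAt μ x)
    (hf : TwiceMDifferentiableAt ((𝓡 n).prod (𝓡 n))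
      (fun p : M × M ↦ objective w (Function.update x i p.1) p.2) (x i, μ x)) (b : M) :
    ∀ᶠ z in 𝓝 (x i), projGradient n ι w b (Function.update x i z)
      (μ (Function.update x i z)) = 0 := by
  have hu := tendsto_update_self x i
  have hp : Tendsto (fun z ↦ (z, μ (Function.update x i z))) (𝓝 (x i)) (𝓝 (x i, μ x)) :=
    tendsto_id.prodMk_nhds (hμc.tendsto.comp hu)
  filter_upwards [hu.eventually hμ, hp.eventually hf.1] with z hz hd
  have hfz : MDifferentiableAt (𝓡 n) 𝓘(ℝ, ℝ) (objective w (Function.update x i z))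
      (μ (Function.update x i z)) :=
    MDifferentiableAt.comp (I' := (𝓡 n).prod (𝓡 n))
      (g := fun p : M × M ↦ objective w (Function.update x i p.1) p.2)
      (f := fun y ↦ (z, y)) _ hd (mdifferentiableAt_const.prodMk mdifferentiableAt_id)
  rw [projGradient, ambientGradient_eq_zero_of_forall_le hι hfz hz, map_zero]

theorem hasMFDerivAt_frechetMean (hι : IsIsometricEmbedding n ι) {w : Fin t → ℝ}
    {x : Fin t → M} {i : Fin t} {μ : (Fin t → M) → M}
    (hμ : ∀ᶠ x' in 𝓝 x, IsFrechetMean w x' (μ x')) (hμc : ContinuousAt μ x)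
    (hf : TwiceMDifferentiableAt ((𝓡 n).prod (𝓡 n))
      (fun p : M × M ↦ objective w (Function.update x i p.1) p.2) (x i, μ x))
    (hinv : (fpYY n ι w x (μ x)).IsInvertible) :
    HasMFDerivAt (𝓡 n) (𝓡 n) (fun z : M ↦ μ (Function.update x i z)) (x i)
      (-((fpYY n ι w x (μ x)).inverse ∘L fpXY n ι w x (μ x) i)) := by
  have hu := tendsto_update_self x i
  have hν : Tendsto (fun z ↦ μ (Function.update x i z)) (𝓝 (x i)) (𝓝 (μ x)) :=
    hμc.tendsto.comp hu
  have hνx : μ (Function.update x i (x i)) = μ x := by rw [Function.update_eq_self]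
  have hs : Tendsto (extChartAt (𝓡 n) (x i)).symm (𝓝 (extChartAt (𝓡 n) (x i) (x i)))
      (𝓝 (x i)) := by
    have h := (continuousAt_extChartAt_symm (I := 𝓡 n) (x i)).tendsto
    rwa [extChartAt_to_inv] at h
  refine ⟨by rw [ContinuousAt, hνx]; exact hν, ?_⟩
  -- The target chart is centred at `μ (update x i (x i))`; it has to be exposed before it can be
  -- rewritten to the chart at `μ x`.
  change HasFDerivWithinAt (extChartAt (𝓡 n) (μ (Function.update x i (x i))) ∘
    (fun z : M ↦ μ (Function.update x i z)) ∘ (extChartAt (𝓡 n) (x i)).symm)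
    (-((fpYY n ι w x (μ x)).inverse ∘L fpXY n ι w x (μ x) i) :
      EuclideanSpace ℝ (Fin n) →L[ℝ] EuclideanSpace ℝ (Fin n)) _ _
  rw [hνx]
  refine HasFDerivAt.hasFDerivWithinAt ?_
  set g := extChartAt (𝓡 n) (μ x) ∘ (fun z : M ↦ μ (Function.update x i z)) ∘
    (extChartAt (𝓡 n) (x i)).symm with hg
  have hgx : g (extChartAt (𝓡 n) (x i) (x i)) = extChartAt (𝓡 n) (μ x) (μ x) := by
    simp only [hg, Function.comp, extChartAt_to_inv, hνx]
  refine hasFDerivAt_of_implicit (G := coordProjGradient ι w x (μ x) i) hinv ?_ ?_ ?_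
  · rw [ContinuousAt, hgx]
    exact (continuousAt_extChartAt (I := 𝓡 n) (μ x)).tendsto.comp (hν.comp hs)
  · rw [hgx]
    exact hasFDerivAt_coordProjGradient hι hf
  · have h0 : ∀ᶠ ζ in 𝓝 (extChartAt (𝓡 n) (x i) (x i)),
        coordProjGradient ι w x (μ x) i (ζ, g ζ) = 0 := by
      -- By continuity the mean stays in the chart domain at `μ x`, so passing to coordinates and
      -- back loses nothing.
      filter_upwards [hs.eventually (eventually_projGradient_eq_zero hι hμ hμc hf (μ x)),
        (hν.comp hs).eventually (extChartAt_source_mem_nhds (I := 𝓡 n) (μ x))] with ζ hζ hζs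
      rw [← hζ, coordProjGradient]
      exact congrArg _ ((extChartAt (𝓡 n) (μ x)).left_inv hζs)
    filter_upwards [h0] with ζ hζ
    rw [hζ, h0.self_of_nhds]

/-- Unlike in the data variable, the projection to `T_y M` moves with `y`; the tangency hypothesis
`hVb` makes its derivative drop out. -/
theorem fpYY_eq_of_extension (hι : IsIsometricEmbedding n ι) {w : Fin t → ℝ} {x : Fin t → M}
    {b : M} {V : EuclideanSpace ℝ (Fin m) → EuclideanSpace ℝ (Fin m)}
    (hV : ∀ᶠ y in 𝓝 b, ambientGradient n ι (objective w x) y = tangentProj n ι y (V (ι y)))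
    (hVd : DifferentiableAt ℝ V (ι b)) (hVb : V (ι b) ∈ ambientTangentSpace n ι b) :
    fpYY n ι w x b =
      fderiv ℝ (fun v ↦ tangentProj n ι b (V v)) (ι b) ∘L mfderiv (𝓡 n) (𝓡 m) ι b := by
  have hb : (ι ∘ (extChartAt (𝓡 n) b).symm) (extChartAt (𝓡 n) b b) = ι b :=
    congrArg ι (extChartAt_to_inv (I := 𝓡 n) b)
  have hVc := HasFDerivAt.comp (extChartAt (𝓡 n) b b) (hb ▸ hVd.hasFDerivAt) (hι.hasFDerivAt b)
  rw [hb] at hVc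
  have h := hasMFDerivAt_tangentProj_tangentProj hι (V := V ∘ ι) hVc hVb
  have h' := h.congr_of_eventuallyEq
    (f₁ := fun y ↦ projGradient n ι w b x y) (by
      filter_upwards [hV] with y hy
      simp only [projGradient, hy, Function.comp])
  have hfd := ((tangentProj n ι b).hasFDerivAt.comp (ι b) hVd.hasFDerivAt).fderiv
  rw [fpYY, h'.mfderiv]
  simp only [Function.comp_def] at hfd
  rw [hfd]
  rfl

end Main

end FrechetMean

theorem mainTheorem2 {n m t : ℕ} {M : Type*} [MetricSpace M]
    [ChartedSpace (EuclideanSpace ℝ (Fin n)) M] [IsManifold (𝓡 n) ∞ M]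
    [RiemannianBundle (fun y : M ↦ TangentSpace (𝓡 n) y)]
    [IsContMDiffRiemannianBundle (𝓡 n) ∞ (EuclideanSpace ℝ (Fin n))
      (fun y : M ↦ TangentSpace (𝓡 n) y)]
    [IsRiemannianManifold (𝓡 n) M]
    (ι : M → EuclideanSpace ℝ (Fin m)) (hι : FrechetMean.IsIsometricEmbedding n ι)
    (w : Fin t → ℝ) (hw : ∀ l, 0 < w l) (x : Fin t → M) (i : Fin t)
    (μ : (Fin t → M) → M)
    (hμ : ∀ᶠ x' in 𝓝 x, FrechetMean.IsFrechetMean w x' (μ x'))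
    (hμc : ContinuousAt μ x)
    (hf : FrechetMean.TwiceMDifferentiableAt ((𝓡 n).prod (𝓡 n))
      (fun p : M × M ↦ FrechetMean.objective w (Function.update x i p.1) p.2) (x i, μ x))
    (hinv : (FrechetMean.fpYY n ι w x (μ x)).IsInvertible) :
    HasMFDerivAt (𝓡 n) (𝓡 n) (fun z : M ↦ μ (Function.update x i z)) (x i)
      (-((FrechetMean.fpYY n ι w x (μ x)).inverse ∘L FrechetMean.fpXY n ι w x (μ x) i)) ∧
    ∀ F : EuclideanSpace ℝ (Fin m) → EuclideanSpace ℝ (Fin m) → ℝ,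
      (∀ᶠ p : M × M in 𝓝 (x i, μ x),
        F (ι p.1) (ι p.2) = FrechetMean.objective w (Function.update x i p.1) p.2) →
      (∀ᶠ q in 𝓝 (ι (x i), ι (μ x)), DifferentiableAt ℝ (F q.1) q.2) →
      (∀ᶠ p : M × M in 𝓝 (x i, μ x),
        FrechetMean.ambientGradient n ι (FrechetMean.objective w (Function.update x i p.1)) p.2 =
          FrechetMean.tangentProj n ι p.2 (gradient (F (ι p.1)) (ι p.2))) ∧
      (DifferentiableAt ℝ
          (fun q : EuclideanSpace ℝ (Fin m) × EuclideanSpace ℝ (Fin m) ↦ gradient (F q.1) q.2)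
          (ι (x i), ι (μ x)) →
        gradient (F (ι (x i))) (ι (μ x)) ∈ FrechetMean.ambientTangentSpace n ι (μ x) →
        FrechetMean.fpYY n ι w x (μ x) =
            fderiv ℝ (fun v ↦ FrechetMean.tangentProj n ι (μ x) (gradient (F (ι (x i))) v))
              (ι (μ x)) ∘L mfderiv (𝓡 n) (𝓡 m) ι (μ x) ∧
        FrechetMean.fpXY n ι w x (μ x) i =
            fderiv ℝ (fun u ↦ FrechetMean.tangentProj n ι (μ x) (gradient (F u) (ι (μ x))))
              (ι (x i)) ∘L mfderiv (𝓡 n) (𝓡 m) ι (x i)) := by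
  refine ⟨FrechetMean.hasMFDerivAt_frechetMean hι hμ hμc hf hinv, fun F hF hFd ↦ ?_⟩
  have hgrad := FrechetMean.eventually_ambientGradient_eq hι
    (f := fun z ↦ FrechetMean.objective w (Function.update x i z)) hF hFd
  refine ⟨hgrad, fun hd hmem ↦ ⟨?_, ?_⟩⟩
  · refine FrechetMean.fpYY_eq_of_extension hι ?_ ?_ hmem
    · have hi : Tendsto (fun y ↦ (x i, y)) (𝓝 (μ x)) (𝓝 (x i, μ x)) :=
        (Continuous.prodMk_right (x i)).tendsto (μ x)
      filter_upwards [hi.eventually hgrad] with y hy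
      simpa only [Function.update_eq_self] using hy
    · exact hd.comp (f := fun v ↦ (ι (x i), v)) (ι (μ x))
        ((differentiableAt_const _).prodMk differentiableAt_id)
  · refine FrechetMean.fpXY_eq_of_extension hι (V := fun u ↦ gradient (F u) (ι (μ x))) ?_ ?_
    · have hi : Tendsto (fun z ↦ (z, μ x)) (𝓝 (x i)) (𝓝 (x i, μ x)) :=
        (Continuous.prodMk_left (μ x)).tendsto (x i)
      exact hi.eventually hgrad
    · exact hd.comp (f := fun u ↦ (u, ι (μ x))) (ι (x i))
        (differentiableAt_id.prodMk (differentiableAt_const _))
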